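/- Let $K$ be a field and let $X$ be a locally finite partially ordered set (possibly empty), i.e. all intervals $\{z : x\le z\le y\}$ are finite. Let $KX$ be the incidence coalgebra of $X$: it has a basis $e_{x,y}$ ($x\le y$ in $X$), with $\Delta(e_{x,y})=\sum_{x\le z\le y}e_{x,z}\otimes e_{z,y}$ and $\varepsilon(e_{x,y})=\delta_{x,y}$. Let $IA(X)$ be the incidence algebra: all functions $f:\{(x,y) : x\le y\}\to K$ with the product $(fg)(x,y)=\sum_{x\le z\le y}f(x,z)g(z,y)$. Let $K^{(X)}$ be the grouplike coalgebra with basis $X$, so $\Delta(x)=x\otimes x$ and $\varepsilon(x)=1$ for $x\in X$, and let $K^X$ be the algebra of all functions $X\to K$ with pointwise operations. The coradical $C_0$ of a coalgebra $C$ is the sum of its simple subcoalgebras. For a unital $K$-algebra $A$, let $A^0\subseteq A^*$ be the space of linear forms whose kernel contains a two-sided ideal of $A$ of finite codimension. $A$ is *reflexive* if the evaluation map $A\to (A^0)^*$, $a\mapsto (f\mapsto f(a))$, is bijective. A coalgebra $C$ is *coreflexive* if the natural map $C\to (C^*)^0$, $c\mapsto (f\mapsto f(c))$, is bijective, where $C^*$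 is the dual algebra with the convolution product. **Theorem 5.8.** The linear map $K^{(X)}\to KX$, $x\mapsto e_{x,x}$, is an injective coalgebra morphism whose image is the coradical $(KX)_0$. Moreover, the following assertions are equivalent: (i) the algebra $IA(X)$ is reflexive; (ii) the coalgebra $KX$ is coreflexive; (iii) the coalgebra $K^{(X)}$ (which is isomorphic to $(KX)_0$ by the above) is coreflexive; (iv) the algebra $K^X$ is reflexive. -/

import Mathlib

open scoped TensorProduct

noncomputable section

namespace IncidenceReflexivity

section FiniteDual

variable (K : Type*) [Field K] (A : Type*) [Ring A] [Algebra K A]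

/-- The finite dual `A⁰` of a `K`-algebra `A`: the linear forms on `A` whose kernel contains a
two-sided ideal of finite codimension. -/
def finiteDual : Submodule K (Module.Dual K A) where
  carrier := {f | ∃ I : Submodule K A, (∀ a, ∀ x ∈ I, a * x ∈ I ∧ x * a ∈ I) ∧
    FiniteDimensional K (A ⧸ I) ∧ I ≤ LinearMap.ker f}
  zero_mem' := by
    exact ⟨⊤, fun _ _ _ => ⟨trivial, trivial⟩, Submodule.CoFG.top, fun _ _ => rfl⟩
  add_mem' := by
    rintro f g ⟨I, hI, hIf, hf⟩ ⟨J, hJ, hJf, hg⟩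
    refine ⟨I ⊓ J, fun a x hx => ⟨⟨(hI a x hx.1).1, (hJ a x hx.2).1⟩,
      ⟨(hI a x hx.1).2, (hJ a x hx.2).2⟩⟩, Submodule.CoFG.inf hIf hJf, fun a ha => ?_⟩
    rw [LinearMap.mem_ker, LinearMap.add_apply, hf ha.1, hg ha.2, add_zero]
  smul_mem' := by
    rintro c f ⟨I, hI, hIf, hf⟩
    refine ⟨I, hI, hIf, fun a ha => ?_⟩
    rw [LinearMap.mem_ker, LinearMap.smul_apply, hf ha, smul_zero]

/-- The evaluation map `Φ : A → (A⁰)*`, `Φ a f = f a`. -/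
def evalFiniteDual : A →ₗ[K] Module.Dual K (finiteDual K A) :=
  (finiteDual K A).subtype.dualMap ∘ₗ Module.Dual.eval K A

/-- The algebra `A` is reflexive: the evaluation map `A → (A⁰)*` is an isomorphism. -/
def IsReflexiveAlgebra : Prop := Function.Bijective (evalFiniteDual K A)

end FiniteDual

section Coreflexive

variable (K : Type*) [Field K] (C : Type*) [AddCommGroup C] [Module K C] [Coalgebra K C]

/-- The dual algebra `C*` of a coalgebra `C`, with the convolution product
`(f * g) c = ∑ f c₁ * g c₂` and unit `ε`. -/
abbrev DualAlgebra : Type _ := WithConv (C →ₗ[K] K)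

/-- The linear form `f ↦ f c` on the dual algebra of `C`. -/
def evalAt : C →ₗ[K] Module.Dual K (DualAlgebra K C) where
  toFun c :=
    { toFun := fun f => f.ofConv c
      map_add' := fun _ _ => rfl
      map_smul' := fun _ _ => rfl }
  map_add' c d := by ext f; exact map_add f.ofConv c d
  map_smul' r c := by ext f; exact map_smul f.ofConv r c

theorem evalAt_mem_finiteDual (c : C) : evalAt K C c ∈ finiteDual K (DualAlgebra K C) := by
  classical
  let R := Coalgebra.Repr.arbitrary K c
  let T : ∀ i, Coalgebra.Repr K (R.left i) (C × C) := fun i => Coalgebra.Repr.arbitrary K (R.left i)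
  let L : DualAlgebra K C →ₗ[K] ((Σ i : R.index, (T i.1).index) → K) :=
    LinearMap.pi fun p => evalAt K C ((T p.1.1).right p.2.1)
  let I : Submodule K (DualAlgebra K C) :=
    { carrier := {f | ∀ g h : DualAlgebra K C, evalAt K C c (g * f * h) = 0}
      zero_mem' := fun g h => by rw [mul_zero, zero_mul, map_zero]
      add_mem' := fun {f f'} hf hf' g h => by
        rw [mul_add, add_mul, map_add, hf g h, hf' g h, add_zero]
      smul_mem' := fun r f hf g h => by
        rw [mul_smul_comm, smul_mul_assoc, map_smul, hf g h, smul_zero] }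
  have hLI : LinearMap.ker L ≤ I := by
    intro f hf g h
    change (g * f * h) c = 0
    rw [R.convMul_apply]
    refine Finset.sum_eq_zero fun i hi => ?_
    rw [(T i).convMul_apply, Finset.sum_eq_zero, zero_mul]
    intro j hj
    have : f ((T i).right j) = 0 := congrFun hf ⟨⟨i, hi⟩, ⟨j, hj⟩⟩
    rw [this, mul_zero]
  refine ⟨I, fun a x hx => ⟨fun g h => ?_, fun g h => ?_⟩, 
    Submodule.CoFG.of_le hLI (Submodule.CoFG.ker L), fun f hf => ?_⟩
  · rw [← mul_assoc]; exact hx (g * a) h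
  · rw [← mul_assoc, mul_assoc]; exact hx g (a * h)
  · have := hf 1 1
    rwa [one_mul, mul_one] at this

/-- The natural map `C → (C*)⁰`, `c ↦ (f ↦ f c)`. -/
def toFiniteDual : C →ₗ[K] finiteDual K (DualAlgebra K C) :=
  (evalAt K C).codRestrict _ (evalAt_mem_finiteDual K C)

/-- The coalgebra `C` is coreflexive: the natural map `C → (C*)⁰` is an isomorphism. -/
def IsCoreflexive : Prop := Function.Bijective (toFiniteDual K C)

variable {C} in
/-- A subspace `D` of `C` is a subcoalgebra if `Δ D ⊆ D ⊗ D`. -/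
def IsSubcoalgebra (D : Submodule K C) : Prop :=
  ∀ d ∈ D, Coalgebra.comul (R := K) d ∈ LinearMap.range (TensorProduct.map D.subtype D.subtype)

variable {C} in
/-- A simple subcoalgebra: a nonzero subcoalgebra without proper nonzero subcoalgebras. -/
def IsSimpleSubcoalgebra (D : Submodule K C) : Prop :=
  IsSubcoalgebra K D ∧ D ≠ ⊥ ∧ ∀ E : Submodule K C, IsSubcoalgebra K E → E ≤ D → E = ⊥ ∨ E = D

/-- The coradical `C₀` of `C`: the sum of all simple subcoalgebras. -/
def coradical : Submodule K C := sSup {D | IsSimpleSubcoalgebra K D}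

end Coreflexive

section Incidence

/-- The underlying space of the incidence coalgebra `KX`: the vector space with basis the
intervals `[x, y]`, `x ≤ y`, of `X`. -/
def IncidenceCoalgebra (K X : Type*) [Field K] [PartialOrder X] : Type _ :=
  NonemptyInterval X →₀ K

namespace IncidenceCoalgebra

variable (K : Type*) [Field K] {X : Type*} [PartialOrder X]

instance : AddCommGroup (IncidenceCoalgebra K X) :=
  inferInstanceAs (AddCommGroup (NonemptyInterval X →₀ K))

instance : Module K (IncidenceCoalgebra K X) :=
  inferInstanceAs (Module K (NonemptyInterval X →₀ K))

/-- The basis `(e_{x,y})` of the incidence coalgebra. -/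
def basis : Module.Basis (NonemptyInterval X) K (IncidenceCoalgebra K X) :=
  ⟨LinearEquiv.refl K (NonemptyInterval X →₀ K)⟩

/-- The basis element `e_{x,y}`, for `x ≤ y`. -/
def e (x y : X) (h : x ≤ y) : IncidenceCoalgebra K X := basis K ⟨(x, y), h⟩

variable [LocallyFiniteOrder X] [DecidableEq X]

/-- `Δ e_{x,y} = ∑_{x ≤ z ≤ y} e_{x,z} ⊗ e_{z,y}` and `ε e_{x,y} = δ_{x,y}`. -/
instance : CoalgebraStruct K (IncidenceCoalgebra K X) where
  comul := (basis K).constr K fun p => ∑ z ∈ (Finset.Icc p.fst p.snd).attach,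
    e K p.fst z.1 (Finset.mem_Icc.1 z.2).1 ⊗ₜ[K] e K z.1 p.snd (Finset.mem_Icc.1 z.2).2
  counit := (basis K).constr K fun p => if p.fst = p.snd then 1 else 0

theorem comul_e (x y : X) (h : x ≤ y) :
    Coalgebra.comul (R := K) (e K x y h) = ∑ z ∈ (Finset.Icc x y).attach,
      e K x z.1 (Finset.mem_Icc.1 z.2).1 ⊗ₜ[K] e K z.1 y (Finset.mem_Icc.1 z.2).2 :=
  (basis K).constr_basis K _ _

theorem counit_e (x y : X) (h : x ≤ y) :
    Coalgebra.counit (R := K) (e K x y h) = if x = y then 1 else 0 :=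
  (basis K).constr_basis K _ _

instance : Coalgebra K (IncidenceCoalgebra K X) where
  coassoc := by
    refine (basis K).ext fun p => ?_
    obtain ⟨⟨x, y⟩, h⟩ := p
    change TensorProduct.assoc K _ _ _ (LinearMap.rTensor _ _ (Coalgebra.comul (e K x y h))) =
      LinearMap.lTensor _ _ (Coalgebra.comul (e K x y h))
    simp only [comul_e, map_sum, LinearMap.rTensor_tmul, LinearMap.lTensor_tmul,
      TensorProduct.sum_tmul, TensorProduct.tmul_sum, TensorProduct.assoc_tmul]
    rw [Finset.sum_sigma', Finset.sum_sigma']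
    refine Finset.sum_bij'
      (fun q _ => ⟨⟨q.2.1, Finset.mem_Icc.2 ⟨(Finset.mem_Icc.1 q.2.2).1,
          (Finset.mem_Icc.1 q.2.2).2.trans (Finset.mem_Icc.1 q.1.2).2⟩⟩,
        ⟨q.1.1, Finset.mem_Icc.2 ⟨(Finset.mem_Icc.1 q.2.2).2, (Finset.mem_Icc.1 q.1.2).2⟩⟩⟩)
      (fun q _ => ⟨⟨q.2.1, Finset.mem_Icc.2 ⟨(Finset.mem_Icc.1 q.1.2).1.trans
          (Finset.mem_Icc.1 q.2.2).1, (Finset.mem_Icc.1 q.2.2).2⟩⟩,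
        ⟨q.1.1, Finset.mem_Icc.2 ⟨(Finset.mem_Icc.1 q.1.2).1, (Finset.mem_Icc.1 q.2.2).1⟩⟩⟩)
      ?_ ?_ ?_ ?_ ?_
    · intro q _; simp
    · intro q _; simp
    · intro q _; rfl
    · intro q _; rfl
    · intro q _; rfl
  rTensor_counit_comp_comul := by
    refine (basis K).ext fun p => ?_
    obtain ⟨⟨x, y⟩, h⟩ := p
    change LinearMap.rTensor _ _ (Coalgebra.comul (e K x y h)) = 1 ⊗ₜ[K] e K x y h
    simp only [comul_e, map_sum, LinearMap.rTensor_tmul, counit_e]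
    rw [Finset.sum_eq_single ⟨x, Finset.left_mem_Icc.2 h⟩]
    · simp
    · intro z _ hz
      rw [if_neg (fun hxz => hz (Subtype.ext hxz.symm)), TensorProduct.zero_tmul]
    · intro hx
      exact absurd (Finset.mem_attach _ _) hx
  lTensor_counit_comp_comul := by
    refine (basis K).ext fun p => ?_
    obtain ⟨⟨x, y⟩, h⟩ := p
    change LinearMap.lTensor _ _ (Coalgebra.comul (e K x y h)) = e K x y h ⊗ₜ[K] 1
    simp only [comul_e, map_sum, LinearMap.lTensor_tmul, counit_e]
    rw [Finset.sum_eq_single ⟨y, Finset.right_mem_Icc.2 h⟩]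
    · simp
    · intro z _ hz
      rw [if_neg (fun hzy => hz (Subtype.ext hzy)), TensorProduct.tmul_zero]
    · intro hy
      exact absurd (Finset.mem_attach _ _) hy

end IncidenceCoalgebra

end Incidence

end IncidenceReflexivity

end

open scoped TensorProduct

noncomputable section

namespace IncidenceReflexivity

/-! ### Functoriality of the finite dual -/

section FiniteDual

variable {K : Type*} [Field K] {A : Type*} [Ring A] [Algebra K A] {B : Type*} [Ring B]
  [Algebra K B]

/-! A coalgebra `C` is coreflexive exactly when `C*` is reflexive
(`isCoreflexive_iff_isReflexiveAlgebra_dualAlgebra`). As `(KX)* ≅ IA(X)` and `(K^(X))* ≅ K^X`, only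
the coreflexivity of `KX` and of `K^(X)` has to be compared. It passes to subcoalgebras
(`IsCoreflexive.of_injective`). For the converse, `isCoreflexive_of_groupLike`, an ideal `I` of
finite codimension in `(KX)*` meets the diagonal copy of `K^X` in an ideal that contains all
functions vanishing on some finite `F ⊆ X`. Modulo `I`, the indicator of `F` then acts as `1` on
both sides, so a form killing `I` depends only on the finitely many entries with both endpoints in
`F`.

The coradical is found by showing that every nonzero subcoalgebra contains some `e_{x,x}`
(`exists_e_self_mem`). -/

theorem cofg_comap {V W : Type*} [AddCommGroup V] [Module K V] [AddCommGroup W] [Module K W]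
    (f : V →ₗ[K] W) {S : Submodule K W} (hS : S.CoFG) : (S.comap f).CoFG := by
  have : FiniteDimensional K (W ⧸ S) := hS
  have h := Submodule.CoFG.ker (S.mkQ ∘ₗ f)
  rwa [LinearMap.ker_comp, Submodule.ker_mkQ] at h

theorem comp_algHom_mem_finiteDual (φ : A →ₐ[K] B) {g : Module.Dual K B}
    (hg : g ∈ finiteDual K B) : g ∘ₗ φ.toLinearMap ∈ finiteDual K A := by
  obtain ⟨I, hI, hfin, hle⟩ := hg
  refine ⟨I.comap φ.toLinearMap, fun a x hx => ?_, cofg_comap _ hfin, fun x hx => hle hx⟩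
  have := hI (φ a) (φ x) hx
  simpa using this

theorem IsReflexiveAlgebra.of_algEquiv (e : A ≃ₐ[K] B) (h : IsReflexiveAlgebra K A) :
    IsReflexiveAlgebra K B := by
  have hmap : (finiteDual K B).map (e.toLinearEquiv.dualMap : Module.Dual K B →ₗ[K] _) =
      finiteDual K A := by
    refine le_antisymm ?_ fun f hf => ?_
    · rintro _ ⟨g, hg, rfl⟩
      exact comp_algHom_mem_finiteDual e.toAlgHom hg
    · refine ⟨_, comp_algHom_mem_finiteDual e.symm.toAlgHom hf, ?_⟩
      ext a
      exact congrArg f (e.symm_apply_apply a)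
  let T := e.toLinearEquiv.dualMap.ofSubmodules _ _ hmap
  have hcomp : ⇑(evalFiniteDual K B) ∘ e = T.dualMap ∘ evalFiniteDual K A := rfl
  have hb : Function.Bijective (⇑(evalFiniteDual K B) ∘ e) :=
    hcomp ▸ T.dualMap.bijective.comp h
  exact (Function.Bijective.of_comp_iff _ e.bijective).1 hb

theorem isReflexiveAlgebra_congr (e : A ≃ₐ[K] B) :
    IsReflexiveAlgebra K A ↔ IsReflexiveAlgebra K B :=
  ⟨.of_algEquiv e, .of_algEquiv e.symm⟩

end FiniteDual

/-! ### Coreflexive coalgebras and subcoalgebras -/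

section Coreflexive

variable {K : Type*} [Field K] {C : Type*} [AddCommGroup C] [Module K C] [Coalgebra K C]
  {D : Type*} [AddCommGroup D] [Module K D] [Coalgebra K D]

/-- Injectivity is automatic, since linear forms separate the points of `C`; only surjectivity is at
stake. -/
theorem isCoreflexive_iff : IsCoreflexive K C ↔
    ∀ g ∈ finiteDual K (DualAlgebra K C), ∃ c : C, ∀ f : DualAlgebra K C, g f = f c := by
  constructor
  · intro h g hg
    obtain ⟨c, hc⟩ := h.2 ⟨g, hg⟩
    exact ⟨c, fun f => (LinearMap.congr_fun (congrArg Subtype.val hc) f).symm⟩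
  · intro h
    refine ⟨(injective_iff_map_eq_zero _).2 fun c hc => ?_, fun g => ?_⟩
    · refine (Module.forall_dual_apply_eq_zero_iff K c).1 fun f => ?_
      exact LinearMap.congr_fun (congrArg Subtype.val hc) (WithConv.toConv f)
    · obtain ⟨c, hc⟩ := h g.1 g.2
      exact ⟨c, Subtype.ext (LinearMap.ext fun f => (hc f).symm)⟩

theorem isCoreflexive_iff_isReflexiveAlgebra_dualAlgebra :
    IsCoreflexive K C ↔ IsReflexiveAlgebra K (DualAlgebra K C) := by
  constructor
  · intro h
    refine ⟨(injective_iff_map_eq_zero _).2 fun a ha => ?_, fun φ => ?_⟩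
    · ext c
      exact LinearMap.congr_fun ha (toFiniteDual K C c)
    · refine ⟨WithConv.toConv (φ ∘ₗ toFiniteDual K C), LinearMap.ext fun g => ?_⟩
      obtain ⟨c, rfl⟩ := h.2 g
      rfl
  · intro h
    refine isCoreflexive_iff.2 fun g hg => ?_
    by_contra hne
    have hmem : g ∉ LinearMap.range (evalAt K C) := fun ⟨c, hc⟩ =>
      hne ⟨c, fun f => (LinearMap.congr_fun hc f).symm⟩
    -- `φ` kills the image of `C` but not `g`. By reflexivity it is evaluation at some `a` on the
    -- finite dual, and `a` vanishes on all of `C`.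
    obtain ⟨φ, hφ, hle⟩ := Submodule.exists_le_ker_of_notMem hmem
    obtain ⟨a, ha'⟩ := h.2 (φ ∘ₗ (finiteDual K (DualAlgebra K C)).subtype)
    have hφa : ∀ f : finiteDual K (DualAlgebra K C), φ f = f.1 a := fun f =>
      (LinearMap.congr_fun ha' f).symm
    have ha : a = 0 := by
      ext c
      exact (hφa ⟨_, evalAt_mem_finiteDual K C c⟩).symm.trans (hle ⟨c, rfl⟩)
    exact hφ ((hφa ⟨g, hg⟩).trans (by rw [ha, map_zero]))

/-- The algebra morphism `D* → C*` dual to a coalgebra morphism `C → D`. -/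
def dualAlgHom (j : C →ₗc[K] D) : DualAlgebra K D →ₐ[K] DualAlgebra K C :=
  AlgHom.ofLinearMap
    { toFun := fun f => WithConv.toConv (f.ofConv ∘ₗ j.toLinearMap)
      map_add' := fun _ _ => rfl
      map_smul' := fun _ _ => rfl }
    (by ext c; exact LinearMap.congr_fun j.counit_comp c)
    (fun f g => WithConv.ext (LinearMap.convMul_comp_coalgHom_distrib f g j))

theorem dualAlgHom_apply (j : C →ₗc[K] D) (f : DualAlgebra K D) (c : C) :
    dualAlgHom j f c = f (j c) := rfl

theorem IsCoreflexive.of_injective (j : C →ₗc[K] D) (hj : Function.Injective j)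
    (h : IsCoreflexive K D) : IsCoreflexive K C := by
  refine isCoreflexive_iff.2 fun g hg => ?_
  obtain ⟨d, hd⟩ := isCoreflexive_iff.1 h _ (comp_algHom_mem_finiteDual (dualAlgHom j) hg)
  -- A form on `D` vanishing on the image of `j` restricts to `0` on `C`, so it must kill `d`.
  have hmem : d ∈ LinearMap.range j.toLinearMap := by
    by_contra hne
    obtain ⟨φ, hφ, hle⟩ := Submodule.exists_le_ker_of_notMem hne
    refine hφ ((hd (WithConv.toConv φ)).symm.trans ?_)
    have : dualAlgHom j (WithConv.toConv φ) = 0 := by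
      ext c
      exact hle ⟨c, rfl⟩
    exact (congrArg g this).trans (map_zero g)
  obtain ⟨c, rfl⟩ := hmem
  refine ⟨c, fun f => ?_⟩
  -- A linear retraction suffices: `f ∘ r` extends `f` to `D`.
  obtain ⟨r, hr⟩ := j.toLinearMap.exists_leftInverse_of_injective (LinearMap.ker_eq_bot.2 hj)
  have hf : dualAlgHom j (WithConv.toConv (f.ofConv ∘ₗ r)) = f := by
    ext x
    exact congrArg f.ofConv (LinearMap.congr_fun hr x)
  have := hd (WithConv.toConv (f.ofConv ∘ₗ r))
  rw [← hf]
  exact this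

/-- In the dual algebra of a coreflexive coalgebra, ideals of finite codimension are open for the
finite topology. -/
theorem IsCoreflexive.exists_finset (h : IsCoreflexive K C) {I : Submodule K (DualAlgebra K C)}
    (hI : ∀ a, ∀ x ∈ I, a * x ∈ I ∧ x * a ∈ I) (hfin : I.CoFG) :
    ∃ s : Finset C, ∀ u : DualAlgebra K C, (∀ c ∈ s, u c = 0) → u ∈ I := by
  classical
  have : FiniteDimensional K (DualAlgebra K C ⧸ I) := hfin
  let b := Module.finBasis K (DualAlgebra K C ⧸ I)
  -- Each coordinate of the quotient by `I` kills `I`, hence is evaluation at an element of `C`.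
  have hc : ∀ i, ∃ c : C, ∀ f : DualAlgebra K C, (b.coord i ∘ₗ I.mkQ) f = f c := fun i =>
    isCoreflexive_iff.1 h _ ⟨I, hI, hfin, fun x hx => by
      simp [(Submodule.Quotient.mk_eq_zero I).2 hx]⟩
  choose c hc using hc
  refine ⟨Finset.univ.image c, fun u hu => ?_⟩
  rw [← Submodule.Quotient.mk_eq_zero]
  refine b.ext_elem fun i => ?_
  rw [map_zero, Finsupp.zero_apply]
  exact (hc i u).trans (hu _ (Finset.mem_image_of_mem c (Finset.mem_univ i)))

theorem isSimpleSubcoalgebra_span_singleton {c : C} (hc : c ≠ 0)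
    (hΔ : Coalgebra.comul (R := K) c = c ⊗ₜ[K] c) : IsSimpleSubcoalgebra K (K ∙ c) := by
  refine ⟨fun d hd => ?_, by simpa using hc, fun E _ hE => ?_⟩
  · obtain ⟨r, rfl⟩ := Submodule.mem_span_singleton.1 hd
    refine ⟨r • (⟨c, Submodule.mem_span_singleton_self c⟩ ⊗ₜ[K]
      ⟨c, Submodule.mem_span_singleton_self c⟩), ?_⟩
    simp [hΔ]
  · rcases (nonzero_span_atom c hc).le_iff.1 hE with h | h
    · exact .inl h
    · exact .inr h

/-- Contracting one tensor leg stays inside `E`; this lets coefficient functionals extract basis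
vectors from a subcoalgebra. -/
theorem IsSubcoalgebra.lTensor_mem {E : Submodule K C} (hE : IsSubcoalgebra K E)
    (g : C →ₗ[K] K) {d : C} (hd : d ∈ E) :
    TensorProduct.rid K C (g.lTensor C (Coalgebra.comul d)) ∈ E := by
  obtain ⟨t, ht⟩ := hE d hd
  rw [← ht]
  clear ht
  induction t with
  | zero => simp
  | tmul x y => simpa using E.smul_mem _ x.2
  | add x y hx hy => simpa using E.add_mem hx hy

theorem IsSubcoalgebra.rTensor_mem {E : Submodule K C} (hE : IsSubcoalgebra K E)
    (g : C →ₗ[K] K) {d : C} (hd : d ∈ E) :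
    TensorProduct.lid K C (g.rTensor C (Coalgebra.comul d)) ∈ E := by
  obtain ⟨t, ht⟩ := hE d hd
  rw [← ht]
  clear ht
  induction t with
  | zero => simp
  | tmul x y => simpa using E.smul_mem _ y.2
  | add x y hx hy => simpa using E.add_mem hx hy

end Coreflexive

/-! ### Dual algebras, and the maps between `KX` and `K^(X)` -/

section Incidence

/-- The dual algebra of the grouplike coalgebra on `X` is the algebra of functions on `X`. -/
def groupLikeDualAlgEquiv (K X : Type*) [Field K] : DualAlgebra K (X →₀ K) ≃ₐ[K] (X → K) := by
  refine AlgEquiv.ofBijective (AlgHom.ofLinearMap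
    { toFun := fun f x => f (Finsupp.single x 1)
      map_add' := fun _ _ => rfl
      map_smul' := fun _ _ => rfl } ?_ fun f g => ?_) ⟨fun f g hfg => ?_, fun f => ?_⟩
  · ext x
    change (1 : DualAlgebra K (X →₀ K)) (Finsupp.single x 1) = 1
    simp
  · ext x
    change (f * g) (Finsupp.single x 1) = f (Finsupp.single x 1) * g (Finsupp.single x 1)
    simp [Finsupp.comul_single]
  · ext x
    exact congrFun hfg x
  · refine ⟨WithConv.toConv (Finsupp.lsum K fun x => LinearMap.toSpanSingleton K K (f x)), ?_⟩
    ext x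
    change Finsupp.lsum K (fun x => LinearMap.toSpanSingleton K K (f x)) (Finsupp.single x 1) = f x
    simp

namespace IncidenceCoalgebra

variable {K : Type*} [Field K] {X : Type*} [PartialOrder X]

theorem basis_apply (p : NonemptyInterval X) : basis K p = e K p.fst p.snd p.fst_le_snd := rfl

theorem dualAlgebra_ext {f g : DualAlgebra K (IncidenceCoalgebra K X)}
    (h : ∀ (x y : X) (hxy : x ≤ y), f (e K x y hxy) = g (e K x y hxy)) : f = g :=
  WithConv.ext ((basis K).ext fun p => h p.fst p.snd p.fst_le_snd)

variable [LocallyFiniteOrder X] [DecidableEq X]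

theorem mul_apply_e (f g : DualAlgebra K (IncidenceCoalgebra K X)) {x y : X} (h : x ≤ y) :
    (f * g) (e K x y h) = ∑ z ∈ (Finset.Icc x y).attach,
      f (e K x z.1 (Finset.mem_Icc.1 z.2).1) * g (e K z.1 y (Finset.mem_Icc.1 z.2).2) := by
  rw [LinearMap.convMul_apply, comul_e]
  simp

theorem one_apply_e {x y : X} (h : x ≤ y) :
    (1 : DualAlgebra K (IncidenceCoalgebra K X)) (e K x y h) = if x = y then 1 else 0 := by
  rw [LinearMap.convOne_apply, counit_e]
  rfl

theorem comul_e_self (x : X) : Coalgebra.comul (R := K) (e K x x le_rfl) =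
    e K x x le_rfl ⊗ₜ[K] e K x x le_rfl := by
  rw [comul_e, Finset.sum_eq_single ⟨x, Finset.mem_Icc.2 ⟨le_rfl, le_rfl⟩⟩]
  · rintro ⟨z, hz⟩ _ hne
    exact absurd (Subtype.ext (Finset.mem_Icc.1 hz |>.2.antisymm (Finset.mem_Icc.1 hz).1)) hne
  · exact fun h => absurd (Finset.mem_attach _ _) h

variable (K X)

/-- The dual algebra of the incidence coalgebra is the incidence algebra. -/
def dualAlgEquiv : DualAlgebra K (IncidenceCoalgebra K X) ≃ₐ[K] IncidenceAlgebra K X := by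
  classical
  refine AlgEquiv.ofBijective (AlgHom.ofLinearMap
    { toFun := fun f => ⟨fun x y => if h : x ≤ y then f (e K x y h) else 0,
        fun x y h => dif_neg h⟩
      map_add' := fun f g => ?_
      map_smul' := fun r f => ?_ } ?_ fun f g => ?_) ⟨fun f g hfg => ?_, fun f => ?_⟩
  · ext x y h
    simp [h]
  · ext x y h
    simp [h, IncidenceAlgebra.constSMul_apply]
  · ext x y h
    exact (dif_pos h).trans (one_apply_e h)
  · ext x y h
    simp only [LinearMap.coe_mk, AddHom.coe_mk, IncidenceAlgebra.coe_mk, dif_pos h, mul_apply_e,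
      IncidenceAlgebra.mul_apply]
    rw [← Finset.sum_attach (Finset.Icc x y)]
    refine Finset.sum_congr rfl fun z _ => ?_
    rw [dif_pos (Finset.mem_Icc.1 z.2).1, dif_pos (Finset.mem_Icc.1 z.2).2]
  · refine dualAlgebra_ext fun x y h => ?_
    have := congrFun (congrFun (congrArg DFunLike.coe hfg) x) y
    simpa [h] using this
  · refine ⟨WithConv.toConv ((basis K).constr K fun p => f p.fst p.snd), ?_⟩
    ext x y h
    exact (dif_pos h).trans ((basis K).constr_basis K _ ⟨(x, y), h⟩)

/-- The inclusion of the grouplike coalgebra on `X` into the incidence coalgebra, `x ↦ e_{x,x}`. -/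
def diagonal : (X →₀ K) →ₗc[K] IncidenceCoalgebra K X where
  toLinearMap := Finsupp.linearCombination K fun x => e K x x le_rfl
  counit_comp := by
    ext x
    simp [counit_e]
  map_comp_comul := by
    ext x
    simp [Finsupp.comul_single, comul_e_self]

variable {X} in
theorem diagonal_single (x : X) : diagonal K X (Finsupp.single x 1) = e K x x le_rfl :=
  (Finsupp.linearCombination_single K 1 x).trans (one_smul K _)

/-- The projection of the incidence coalgebra onto the grouplike coalgebra on `X`, sending
`e_{x,x}` to `x` and `e_{x,y}` to `0` for `x < y`. -/
def toDiagonal : IncidenceCoalgebra K X →ₗc[K] (X →₀ K) where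
  toLinearMap := (basis K).constr K fun p =>
    if p.fst = p.snd then Finsupp.single p.fst 1 else 0
  counit_comp := by
    refine (basis K).ext fun p => ?_
    rw [LinearMap.comp_apply, Module.Basis.constr_basis, basis_apply, counit_e]
    split_ifs <;> simp
  map_comp_comul := by
    refine (basis K).ext fun ⟨⟨x, y⟩, h⟩ => ?_
    have hb : ∀ (a b : X) (hab : a ≤ b), (basis K).constr K (fun p : NonemptyInterval X =>
        if p.fst = p.snd then Finsupp.single p.fst (1 : K) else 0) (e K a b hab) =
        if a = b then Finsupp.single a 1 else 0 := fun a b hab =>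
      (basis K).constr_basis K _ ⟨(a, b), hab⟩
    change TensorProduct.map _ _ (Coalgebra.comul (e K x y h)) =
      Coalgebra.comul ((basis K).constr K _ (e K x y h))
    simp only [comul_e, map_sum, TensorProduct.map_tmul, hb]
    -- The left factor leaves only `z = x`; the right factor then vanishes unless `x = y`.
    rw [Finset.sum_eq_single ⟨x, Finset.left_mem_Icc.2 h⟩]
    · by_cases hxy : x = y <;> simp [hxy, Finsupp.comul_single]
    · intro z _ hz
      rw [if_neg (fun hxz => hz (Subtype.ext hxz.symm)), TensorProduct.zero_tmul]
    · exact fun hx => absurd (Finset.mem_attach _ _) hx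

variable {X} in
theorem toDiagonal_e {x y : X} (h : x ≤ y) : toDiagonal K X (e K x y h) =
    if x = y then Finsupp.single x 1 else 0 :=
  (basis K).constr_basis K _ _

theorem diagonal_injective : Function.Injective (diagonal K X) := by
  have h : (toDiagonal K X).toLinearMap ∘ₗ (diagonal K X).toLinearMap = LinearMap.id := by
    ext x : 2
    change toDiagonal K X (diagonal K X (Finsupp.single x 1)) = Finsupp.single x 1
    rw [diagonal_single, toDiagonal_e, if_pos rfl]
  exact Function.LeftInverse.injective (g := toDiagonal K X) (LinearMap.congr_fun h)

/-! ### The coradical of `KX` -/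

variable {K X}

/-- Pick `[x, y]` in the support of `d ∈ D`. Contracting the right leg of `Δ d` with the coordinate
at `[x, y]` leaves a combination of the `e_{a,x}`; contracting the left leg of its coproduct with
the coordinate at `[x, x]` leaves `e_{x,x}` times the coefficient of `d` at `[x, y]`. -/
theorem exists_e_self_mem {D : Submodule K (IncidenceCoalgebra K X)}
    (hD : IsSubcoalgebra K D) (hne : D ≠ ⊥) : ∃ x : X, e K x x le_rfl ∈ D := by
  obtain ⟨d, hd, hd0⟩ := Submodule.exists_mem_ne_zero_of_ne_bot hne
  obtain ⟨⟨⟨x, y⟩, h⟩, hxy⟩ : ∃ p, (basis K).repr d p ≠ 0 := by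
    by_contra! hall
    exact hd0 ((basis K).ext_elem fun p => by simpa using hall p)
  refine ⟨x, ?_⟩
  have hmem := hD.rTensor_mem ((basis K).coord ⟨(x, x), le_rfl⟩)
    (hD.lTensor_mem ((basis K).coord ⟨(x, y), h⟩) hd)
  have hcoord : ∀ (p : NonemptyInterval X) (a b : X) (hab : a ≤ b),
      (basis K).coord p (e K a b hab) = if a = p.fst ∧ b = p.snd then 1 else 0 := by
    rintro ⟨⟨x, y⟩, h⟩ a b hab
    rw [e, Module.Basis.coord_apply, Module.Basis.repr_self, Finsupp.single_apply]
    simp [NonemptyInterval.ext_iff]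
  have key : ∀ c : IncidenceCoalgebra K X,
      TensorProduct.lid K _ (((basis K).coord ⟨(x, x), le_rfl⟩).rTensor _ (Coalgebra.comul
        (TensorProduct.rid K _ (((basis K).coord ⟨(x, y), h⟩).lTensor _
          (Coalgebra.comul c))))) = (basis K).coord ⟨(x, y), h⟩ c • e K x x le_rfl := by
    classical
    have hlin : (TensorProduct.lid K _).toLinearMap ∘ₗ
        ((basis K).coord ⟨(x, x), le_rfl⟩).rTensor _ ∘ₗ Coalgebra.comul ∘ₗ
        (TensorProduct.rid K _).toLinearMap ∘ₗ
        ((basis K).coord ⟨(x, y), h⟩).lTensor _ ∘ₗ Coalgebra.comul =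
        ((basis K).coord ⟨(x, y), h⟩).smulRight (e K x x le_rfl) := by
      refine (basis K).ext fun ⟨⟨a, b⟩, hab⟩ => ?_
      have hinner : TensorProduct.rid K _ (((basis K).coord ⟨(x, y), h⟩).lTensor _
          (Coalgebra.comul (e K a b hab))) =
          if hx : a ≤ x ∧ b = y then e K a x hx.1 else 0 := by
        simp only [comul_e, map_sum, LinearMap.lTensor_tmul, hcoord, TensorProduct.rid_tmul]
        split_ifs with hx
        · rw [Finset.sum_eq_single ⟨x, Finset.mem_Icc.2 ⟨hx.1, hx.2 ▸ h⟩⟩]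
          · simp [hx.2]
          · intro z _ hz
            rw [if_neg fun hzx => hz (Subtype.ext hzx.1), zero_smul]
          · exact fun hz => absurd (Finset.mem_attach _ _) hz
        · refine Finset.sum_eq_zero fun z _ => ?_
          rw [if_neg, zero_smul]
          rintro ⟨hzx, hby⟩
          exact hx ⟨(Finset.mem_Icc.1 z.2).1.trans_eq hzx, hby⟩
      have houter : ∀ hax : a ≤ x, TensorProduct.lid K _
          (((basis K).coord ⟨(x, x), le_rfl⟩).rTensor _ (Coalgebra.comul (e K a x hax))) =
          if a = x then e K x x le_rfl else 0 := by
        intro hax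
        simp only [comul_e, map_sum, LinearMap.rTensor_tmul, hcoord, TensorProduct.lid_tmul]
        split_ifs with hx
        · subst hx
          rw [Finset.sum_eq_single ⟨a, Finset.mem_Icc.2 ⟨le_rfl, le_rfl⟩⟩]
          · simp
          · intro z _ hz
            rw [if_neg fun hzx => hz (Subtype.ext hzx.2), zero_smul]
          · exact fun hz => absurd (Finset.mem_attach _ _) hz
        · refine Finset.sum_eq_zero fun z _ => ?_
          rw [if_neg fun hz => hx hz.1, zero_smul]
      change TensorProduct.lid K _ (((basis K).coord ⟨(x, x), le_rfl⟩).rTensor _ (Coalgebra.comul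
        (TensorProduct.rid K _ (((basis K).coord ⟨(x, y), h⟩).lTensor _
          (Coalgebra.comul (e K a b hab)))))) =
        (basis K).coord ⟨(x, y), h⟩ (e K a b hab) • e K x x le_rfl
      rw [hinner, hcoord]
      by_cases hx : a ≤ x ∧ b = y
      · rw [dif_pos hx, houter]
        simp [hx.2]
      · rw [dif_neg hx, if_neg fun hab => hx ⟨hab.1.le, hab.2⟩]
        simp
    exact LinearMap.congr_fun hlin
  rw [key] at hmem
  exact (D.smul_mem_iff hxy).1 hmem

/-- A simple subcoalgebra contains some `e_{x,x}`, whose line is itself a subcoalgebra, so the two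
coincide. -/
theorem range_diagonal : LinearMap.range (diagonal K X).toLinearMap =
    coradical K (IncidenceCoalgebra K X) := by
  have hsimple : ∀ x : X, IsSimpleSubcoalgebra K (K ∙ e K x x le_rfl) := fun x =>
    isSimpleSubcoalgebra_span_singleton ((basis K).ne_zero ⟨(x, x), le_rfl⟩) (comul_e_self x)
  have hrange : LinearMap.range (diagonal K X).toLinearMap =
      Submodule.span K (Set.range fun x : X => e K x x le_rfl) :=
    Finsupp.range_linearCombination K
  rw [hrange]
  refine le_antisymm (Submodule.span_le.2 ?_) (sSup_le fun D hD => ?_)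
  · rintro _ ⟨x, rfl⟩
    exact (le_sSup (hsimple x) : _ ≤ coradical K _) (Submodule.mem_span_singleton_self _)
  · obtain ⟨x, hx⟩ := exists_e_self_mem hD.1 hD.2.1
    have hle : (K ∙ e K x x le_rfl) ≤ D := (Submodule.span_singleton_le_iff_mem _ _).2 hx
    rcases hD.2.2 _ (hsimple x).1 hle with h | h
    · exact absurd h (hsimple x).2.1
    · rw [← h]
      exact Submodule.span_mono (Set.singleton_subset_iff.2 ⟨x, rfl⟩)

/-! ### Coreflexivity passes from `K^(X)` to `KX` -/

/-- The diagonal element of the dual algebra of the incidence coalgebra with entries `h`. -/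
def diag (h : X → K) : DualAlgebra K (IncidenceCoalgebra K X) :=
  dualAlgHom (toDiagonal K X) ((groupLikeDualAlgEquiv K X).symm h)

theorem diag_e (h : X → K) {x y : X} (hxy : x ≤ y) :
    diag h (e K x y hxy) = if x = y then h x else 0 := by
  rw [diag, dualAlgHom_apply, toDiagonal_e]
  split_ifs
  · exact congrFun ((groupLikeDualAlgEquiv K X).apply_symm_apply h) x
  · exact map_zero _

theorem diag_mul_apply (h : X → K) (f : DualAlgebra K (IncidenceCoalgebra K X)) {x y : X}
    (hxy : x ≤ y) : (diag h * f) (e K x y hxy) = h x * f (e K x y hxy) := by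
  simp only [mul_apply_e, diag_e]
  rw [Finset.sum_eq_single ⟨x, Finset.left_mem_Icc.2 hxy⟩]
  · simp
  · intro z _ hz
    rw [if_neg (fun hxz => hz (Subtype.ext hxz.symm)), zero_mul]
  · exact fun hx => absurd (Finset.mem_attach _ _) hx

theorem mul_diag_apply (h : X → K) (f : DualAlgebra K (IncidenceCoalgebra K X)) {x y : X}
    (hxy : x ≤ y) : (f * diag h) (e K x y hxy) = f (e K x y hxy) * h y := by
  simp only [mul_apply_e, diag_e]
  rw [Finset.sum_eq_single ⟨y, Finset.right_mem_Icc.2 hxy⟩]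
  · simp
  · intro z _ hz
    rw [if_neg (fun hzy => hz (Subtype.ext hzy)), mul_zero]
  · exact fun hy => absurd (Finset.mem_attach _ _) hy

/-- Pulled back to the dual of `K^(X)`, `I` is open for the finite topology; the supports of the
finitely many test elements make up `F`. -/
theorem exists_finset_diag_mem (hX : IsCoreflexive K (X →₀ K))
    {I : Submodule K (DualAlgebra K (IncidenceCoalgebra K X))}
    (hI : ∀ a, ∀ x ∈ I, a * x ∈ I ∧ x * a ∈ I) (hfin : I.CoFG) :
    ∃ F : Finset X, ∀ h : X → K, (∀ x ∈ F, h x = 0) → diag h ∈ I := by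
  obtain ⟨s, hs⟩ := hX.exists_finset
    (I := I.comap (dualAlgHom (toDiagonal K X)).toLinearMap)
    (fun a x hx => by simpa using hI (dualAlgHom (toDiagonal K X) a) _ hx) (cofg_comap _ hfin)
  refine ⟨s.biUnion Finsupp.support, fun h hh => hs _ fun c hc => ?_⟩
  set u := (groupLikeDualAlgEquiv K X).symm h
  have hu : ∀ x, u (Finsupp.single x 1) = h x :=
    congrFun ((groupLikeDualAlgEquiv K X).apply_symm_apply h)
  rw [← c.sum_single, Finsupp.sum, map_sum]
  refine Finset.sum_eq_zero fun x hx => ?_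
  rw [← mul_one (c x), ← smul_eq_mul, ← Finsupp.smul_single, map_smul, hu,
    hh x (Finset.mem_biUnion.2 ⟨c, hc, hx⟩), smul_zero]

theorem isCoreflexive_of_groupLike (hX : IsCoreflexive K (X →₀ K)) :
    IsCoreflexive K (IncidenceCoalgebra K X) := by
  refine isCoreflexive_iff.2 ?_
  rintro g ⟨I, hI, hfin, hle⟩
  obtain ⟨F, hF⟩ := exists_finset_diag_mem hX hI hfin
  let m : DualAlgebra K (IncidenceCoalgebra K X) := diag fun x => if x ∈ F then 1 else 0
  let n : DualAlgebra K (IncidenceCoalgebra K X) := diag fun x => if x ∈ F then 0 else 1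
  have hn : n ∈ I := hF _ fun x hx => if_pos hx
  let P : Finset (NonemptyInterval X) :=
    (F ×ˢ F).preimage NonemptyInterval.toProd (NonemptyInterval.toProd_injective.injOn)
  let E : NonemptyInterval X → DualAlgebra K (IncidenceCoalgebra K X) := fun p =>
    WithConv.toConv ((basis K).coord p)
  -- Forced by `g f = g (m * f * m)` and the expansion of `m * f * m` in the dual vectors `E p`.
  refine ⟨∑ p ∈ P, g (E p) • basis K p, fun f => ?_⟩
  -- Here `m + n = 1`, and both terms on the right lie in `I` because `n` does.
  have hsub : f - m * f * m = n * f + m * f * n := by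
    refine dualAlgebra_ext fun x y h => ?_
    change f (e K x y h) - (m * f * m) (e K x y h) =
      (n * f) (e K x y h) + (m * f * n) (e K x y h)
    simp only [m, n, mul_diag_apply, diag_mul_apply]
    split_ifs <;> ring
  have hker : g f = g (m * f * m) := by
    refine sub_eq_zero.1 ((map_sub g _ _).symm.trans (hle ?_))
    rw [hsub]
    exact I.add_mem (hI _ _ hn).2 (hI _ _ hn).1
  have hmfm : m * f * m = ∑ p ∈ P, f (basis K p) • E p := by
    refine WithConv.ext ((basis K).ext fun q => ?_)
    have hr : (∑ p ∈ P, f (basis K p) • E p).ofConv (basis K q) =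
        ∑ p ∈ P, f (basis K p) * (basis K).coord p (basis K q) := by
      change (WithConv.linearEquiv K _ (∑ p ∈ P, f (basis K p) • E p)) (basis K q) = _
      rw [map_sum, LinearMap.sum_apply]
      rfl
    rw [hr]
    change (m * f * m) (e K q.fst q.snd q.fst_le_snd) = _
    have hq : q ∈ P ↔ q.fst ∈ F ∧ q.snd ∈ F := by
      simp [P]
    simp only [m, mul_diag_apply, diag_mul_apply, Module.Basis.coord_apply,
      Module.Basis.repr_self, Finsupp.single_apply, mul_ite, mul_one, mul_zero, ite_mul, one_mul,
      zero_mul, Finset.sum_ite_eq, hq]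
    split_ifs <;> first | rfl | tauto
  rw [hker, hmfm, map_sum, map_sum]
  refine Finset.sum_congr rfl fun p _ => ?_
  rw [map_smul, map_smul, smul_eq_mul, smul_eq_mul, mul_comm]

end IncidenceCoalgebra

end Incidence

end IncidenceReflexivity

end

theorem theorem5p8 (K : Type*) [Field K] (X : Type*) [PartialOrder X] [LocallyFiniteOrder X]
    [DecidableEq X] :
    (∃ j : (X →₀ K) →ₗc[K] IncidenceReflexivity.IncidenceCoalgebra K X,
      (∀ x : X, j (Finsupp.single x 1) = IncidenceReflexivity.IncidenceCoalgebra.e K x x le_rfl) ∧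
      Function.Injective j ∧
      LinearMap.range j.toLinearMap =
        IncidenceReflexivity.coradical K (IncidenceReflexivity.IncidenceCoalgebra K X)) ∧
    List.TFAE [
      IncidenceReflexivity.IsReflexiveAlgebra K (IncidenceAlgebra K X),
      IncidenceReflexivity.IsCoreflexive K (IncidenceReflexivity.IncidenceCoalgebra K X),
      IncidenceReflexivity.IsCoreflexive K (X →₀ K),
      IncidenceReflexivity.IsReflexiveAlgebra K (X → K)] := by
  open IncidenceReflexivity IncidenceCoalgebra in
  refine ⟨⟨diagonal K X, diagonal_single K, diagonal_injective K X, range_diagonal⟩, ?_⟩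
  tfae_have 2 ↔ 1 := isCoreflexive_iff_isReflexiveAlgebra_dualAlgebra.trans
    (isReflexiveAlgebra_congr (dualAlgEquiv K X))
  tfae_have 2 → 3 := .of_injective (diagonal K X) (diagonal_injective K X)
  tfae_have 3 → 2 := isCoreflexive_of_groupLike
  tfae_have 3 ↔ 4 := isCoreflexive_iff_isReflexiveAlgebra_dualAlgebra.trans
    (isReflexiveAlgebra_congr (groupLikeDualAlgEquiv K X))
  tfae_finish
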